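/- For subsets $A,B,C$ of $[n]=\{1,\dots,n\}$ put $d(A,B,C)=|A\cap B|+|B\cap C|+|C\cap A|$, and let $h(n,\ell)$ denote the largest size of a family $\mathcal F\subseteq 2^{[n]}$ such that $d(A,B,C)\ge \ell$ for any three distinct members $A,B,C\in\mathcal F$. Let $p\ge 1$ and $0\le q\le 5$ be integers, let $x=6p+q$, and let $n\ge 2^{3p+2}p^2+p+1$ be an integer. Then $$ h(n,3n-x)= \begin{cases} \sum_{i=0}^{p}\binom{n}{i} & \text{if } q\in\{0,1\},\\[2pt] \sum_{i=0}^{p}\binom{n}{i}+\binom{n-2}{p-1} & \text{if } q=2,\\[2pt] \sum_{i=0}^{p}\binom{n}{i}+\binom{n-1}{p} & \text{if } q\in\{3,4\},\\[2pt] \sum_{i=0}^{p}\binom{n}{i}+\binom{n-1}{p}+\binom{n-2}{p} & \text{if } q=5. \end{cases} $$ -/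

import Mathlib

namespace TripleSystem

/-- `d(A,B,C) = |A ∩ B| + |B ∩ C| + |C ∩ A|` for subsets of an `n`-element ground set. -/
def d {n : ℕ} (A B C : Finset (Fin n)) : ℕ :=
  (A ∩ B).card + (B ∩ C).card + (C ∩ A).card

/-- The class `H_ℓ`: families such that `d(A,B,C) ≥ ℓ` for any three distinct members. -/
def InH {n : ℕ} (ℓ : ℕ) (F : Finset (Finset (Fin n))) : Prop :=
  ∀ A ∈ F, ∀ B ∈ F, ∀ C ∈ F, A ≠ B → B ≠ C → A ≠ C → ℓ ≤ d A B C

instance {n : ℕ} (ℓ : ℕ) : DecidablePred (InH (n := n) ℓ) := fun F => by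
  unfold InH; infer_instance

/-- `h(n,ℓ)`: the largest size of a family of subsets of an `n`-element set that is in `H_ℓ`.
The maximum is over a finite collection, which contains the empty family. -/
def h (n ℓ : ℕ) : ℕ :=
  (Finset.univ.filter fun F : Finset (Finset (Fin n)) => InH ℓ F).sup Finset.card

end TripleSystem

namespace TripleSystem

open Finset

/-! Since |A ∩ B| = n - |Aᶜ ∪ Bᶜ|, complementing turns the condition into: the pairwise unions of
any three members have total size at most 6p + q. The extremal families consist of all sets of size
at most p and, for q ≥ 2, the (p+1)-sets that contain a fixed pair (q = 2), contain a fixed point (q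
= 3, 4), or meet a fixed pair (q = 5).

For the upper bound, if all members have fewer than p points outside one set Y with |Y| ≤ 3p + 2,
then there are only O(n^(p-1)) of them, hence at most C(n,p) for large n
(`card_le_choose_of_sdiff_lt`). Taking Y to be an oversized union or an oversized member, one may
assume that unions and members are small. If all members have size at most p + 1, the top layer is
bounded by Erdős–Ko–Rado, or for q = 2 by `card_le_of_two_le_card_inter`.

A union Y of size 2p + 2 escapes this only for q ≥ 4: it allows members with exactly p points
outside Y, whose trace on Y is empty or, for q = 5, possibly a singleton. Counting by trace suffices
unless two singleton traces are frequent; then `UnionBounded.subset_ballWith_or` places the family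
inside the extremal one. -/

/-- The complementary form of `InH`: the pairwise unions of any three distinct members have total
size at most `x`. -/
def UnionBounded {n : ℕ} (x : ℕ) (G : Finset (Finset (Fin n))) : Prop :=
  ∀ A ∈ G, ∀ B ∈ G, ∀ C ∈ G, A ≠ B → B ≠ C → A ≠ C → #(A ∪ B) + #(B ∪ C) + #(C ∪ A) ≤ x

/-! ### Passing to complements -/

lemma card_inter_add_card_union_compl {n : ℕ} (A B : Finset (Fin n)) :
    #(A ∩ B) + #(Aᶜ ∪ Bᶜ) = n := by
  rw [← compl_inter, card_add_card_compl, Fintype.card_fin]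

lemma inH_iff_unionBounded_compls {n x : ℕ} (F : Finset (Finset (Fin n))) :
    InH (3 * n - x) F ↔ UnionBounded x (F.image compl) := by
  have key (A B C : Finset (Fin n)) :
      3 * n - x ≤ d A B C ↔ #(Aᶜ ∪ Bᶜ) + #(Bᶜ ∪ Cᶜ) + #(Cᶜ ∪ Aᶜ) ≤ x := by
    have h1 := card_inter_add_card_union_compl A B
    have h2 := card_inter_add_card_union_compl B C
    have h3 := card_inter_add_card_union_compl C A
    unfold d
    -- Truncated subtraction is harmless: `d` plus the three unions is 3n, and both sides hold when
    -- x ≥ 3n.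
    omega
  simp only [InH, UnionBounded, key, forall_mem_image, ne_eq, compl_inj_iff]

lemma h_eq_of_unionBounded {n x v : ℕ}
    (upper : ∀ G : Finset (Finset (Fin n)), UnionBounded x G → #G ≤ v)
    (lower : ∃ G : Finset (Finset (Fin n)), UnionBounded x G ∧ #G = v) :
    h n (3 * n - x) = v := by
  have hcard (G : Finset (Finset (Fin n))) : #(G.image compl) = #G :=
    card_image_of_injective _ compl_injective
  apply le_antisymm
  · refine Finset.sup_le fun F hF => ?_
    rw [← hcard]
    exact upper _ ((inH_iff_unionBounded_compls F).1 (mem_filter.1 hF).2)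
  · obtain ⟨G, hG, rfl⟩ := lower
    rw [← hcard]
    refine Finset.le_sup (f := Finset.card) (mem_filter.2 ⟨mem_univ _, ?_⟩)
    rw [inH_iff_unionBounded_compls, image_image]
    simpa using hG

/-! ### Binomial estimates and counting by traces -/

lemma choose_le_choose_of_le_half {N a b : ℕ} (hab : a ≤ b) (hb : 2 * b ≤ N) :
    N.choose a ≤ N.choose b := by
  induction b, hab using Nat.le_induction with
  | base => exact le_rfl
  | succ b _ ih => exact (ih (by omega)).trans (Nat.choose_le_succ_of_lt_half_left (by omega))

lemma mul_choose_le_choose_succ {c N k : ℕ} (h : c * (k + 1) + k ≤ N) :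
    c * N.choose k ≤ N.choose (k + 1) := by
  refine Nat.le_of_mul_le_mul_right (c := k + 1) ?_ k.succ_pos
  rw [Nat.choose_succ_right_eq, mul_right_comm, mul_comm (N.choose k)]
  exact Nat.mul_le_mul_right _ (by omega)

/-- Few sets have fewer than `k` elements outside a bounded set `Y`. -/
lemma card_filter_sdiff_lt_le {n k : ℕ} (G : Finset (Finset (Fin n))) (Y : Finset (Fin n))
    (hk : #Y + 2 * k ≤ n) :
    #{C ∈ G | #(C \ Y) < k} ≤ 2 ^ #Y * (k * (n - #Y).choose (k - 1)) := by
  have hinj : Set.InjOn (fun C : Finset (Fin n) => (C ∩ Y, C \ Y))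
      (({C ∈ G | #(C \ Y) < k} : Finset _) : Set (Finset (Fin n))) := by
    intro C _ D _ hCD
    simp only [Prod.mk.injEq] at hCD
    rw [← sdiff_union_inter C Y, ← sdiff_union_inter D Y, hCD.1, hCD.2]
  have hmaps : ∀ C ∈ ({C ∈ G | #(C \ Y) < k} : Finset _), (C ∩ Y, C \ Y) ∈
      Y.powerset ×ˢ (range k).biUnion fun i => powersetCard i Yᶜ := by
    intro C hC
    simp only [mem_product, mem_powerset, mem_biUnion, mem_range, mem_powersetCard]
    refine ⟨inter_subset_right, _, (mem_filter.1 hC).2, ?_, rfl⟩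
    rw [sdiff_eq_inter_compl]
    exact inter_subset_right
  refine (card_le_card_of_injOn _ hmaps hinj).trans ?_
  rw [card_product, card_powerset]
  refine Nat.mul_le_mul_left _ ?_
  have := card_biUnion_le_card_mul (range k) (fun i => powersetCard i Yᶜ)
    ((n - #Y).choose (k - 1)) ?_
  · simpa using this
  · intro i hi
    rw [card_powersetCard, card_compl, Fintype.card_fin]
    have := mem_range.1 hi
    exact choose_le_choose_of_le_half (by omega) (by omega)

/-- A lower bound for the three pairwise unions in terms of the parts of `C` outside and inside
`A ∪ B`. -/
lemma two_mul_card_union_add_le {n : ℕ} (A B C : Finset (Fin n)) :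
    2 * #(A ∪ B) + 2 * #(C \ (A ∪ B)) + #(C ∩ (A ∪ B)) ≤ #(A ∪ B) + #(B ∪ C) + #(C ∪ A) := by
  -- The last two unions together cover A ∪ B ∪ C once and C a second time.
  have h1 := card_union_add_card_inter (B ∪ C) (C ∪ A)
  have h2 : (B ∪ C) ∪ (C ∪ A) = (A ∪ B) ∪ C := by grind
  have h3 : C ⊆ (B ∪ C) ∩ (C ∪ A) := by grind
  have h4 := card_le_card h3
  have h5 := card_union_add_card_inter (A ∪ B) C
  have h6 := card_sdiff_add_card_inter C (A ∪ B)
  rw [inter_comm] at h5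
  rw [h2] at h1
  omega

lemma injOn_sdiff_of_trace {n : ℕ} (G : Finset (Finset (Fin n))) (Y T : Finset (Fin n)) (p : ℕ) :
    Set.InjOn (· \ Y)
      (({C ∈ G | C ∩ Y = T ∧ #(C \ Y) = p} : Finset _) : Set (Finset (Fin n))) := by
  intro C hC D hD hCD
  have hC := (mem_filter.1 (mem_coe.1 hC)).2.1
  have hD := (mem_filter.1 (mem_coe.1 hD)).2.1
  rw [← sdiff_union_inter C Y, ← sdiff_union_inter D Y, hC, hD]
  exact congrArg (· ∪ T) hCD

/-- A large family with a common trace on `Y` and `p` further elements per member has a member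
whose further elements avoid `Z`. -/
lemma exists_trace_disjoint {n p : ℕ} (hp : 1 ≤ p) {G : Finset (Finset (Fin n))}
    {Y T Z : Finset (Fin n)}
    (hG : #Z * (n - 1).choose (p - 1) < #{C ∈ G | C ∩ Y = T ∧ #(C \ Y) = p}) :
    ∃ C ∈ G, C ∩ Y = T ∧ #(C \ Y) = p ∧ Disjoint (C \ Y) Z := by
  by_contra! hcon
  refine hG.not_ge ?_
  have hmaps : ∀ C ∈ ({C ∈ G | C ∩ Y = T ∧ #(C \ Y) = p} : Finset _), C \ Y ∈
      Z.biUnion fun z => (powersetCard p univ).filter ({z} ⊆ ·) := by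
    intro C hC
    obtain ⟨hCG, hT, hc⟩ := mem_filter.1 hC
    obtain ⟨z, hz1, hz2⟩ := not_disjoint_iff.1 (hcon C hCG hT hc)
    simp only [mem_biUnion, mem_filter, mem_powersetCard_univ, singleton_subset_iff]
    exact ⟨z, hz2, hc, hz1⟩
  refine (card_le_card_of_injOn _ hmaps (injOn_sdiff_of_trace ..)).trans ?_
  refine card_biUnion_le_card_mul _ _ _ fun z _ => ?_
  rw [card_filter_powersetCard_subset] <;> simp [hp]

lemma card_filter_trace_le {n p : ℕ} (G : Finset (Finset (Fin n))) (Y T : Finset (Fin n)) :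
    #{C ∈ G | C ∩ Y = T ∧ #(C \ Y) = p} ≤ (n - #Y).choose p := by
  have hmaps : ∀ C ∈ ({C ∈ G | C ∩ Y = T ∧ #(C \ Y) = p} : Finset _), C \ Y ∈
      powersetCard p Yᶜ := by
    intro C hC
    refine mem_powersetCard.2 ⟨?_, (mem_filter.1 hC).2.2⟩
    rw [sdiff_eq_inter_compl]
    exact inter_subset_right
  refine (card_le_card_of_injOn _ hmaps (injOn_sdiff_of_trace ..)).trans ?_
  rw [card_powersetCard, card_compl, Fintype.card_fin]

lemma card_filter_card_le {n p : ℕ} :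
    #{S : Finset (Fin n) | #S ≤ p} = ∑ i ∈ range (p + 1), n.choose i := by
  have : ({S : Finset (Fin n) | #S ≤ p} : Finset _) =
      (range (p + 1)).biUnion fun i => powersetCard i univ := by
    ext S
    simp
  rw [this, card_biUnion]
  · simp
  · intro i _ j _ hij
    exact pairwise_disjoint_powersetCard _ hij

lemma mul_le_two_pow_mul_sq {p : ℕ} (hp : 1 ≤ p) : 32 * p ≤ 2 ^ (3 * p + 2) * p ^ 2 := by
  have h1 : 2 ^ 5 ≤ 2 ^ (3 * p + 2) := Nat.pow_le_pow_right (by norm_num) (by omega)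
  exact Nat.mul_le_mul h1 (Nat.le_self_pow (by norm_num) p)

/-- The ratio of the two binomials is (n-p+1)/p; the threshold on n is chosen to make it at least
2^(3p+2) p. -/
lemma two_pow_mul_choose_le {n p : ℕ} (hp : 1 ≤ p) (hn : 2 ^ (3 * p + 2) * p ^ 2 + p + 1 ≤ n) :
    2 ^ (3 * p + 2) * (p * n.choose (p - 1)) ≤ n.choose p := by
  obtain ⟨k, rfl⟩ := Nat.exists_eq_add_of_le' hp
  rw [← mul_assoc]
  refine mul_choose_le_choose_succ ?_
  rw [Nat.add_sub_cancel, mul_assoc, ← sq]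
  omega

lemma card_filter_sdiff_lt_le_choose {n p : ℕ} (hp : 1 ≤ p)
    (hn : 2 ^ (3 * p + 2) * p ^ 2 + p + 1 ≤ n) (G : Finset (Finset (Fin n)))
    {Y : Finset (Fin n)} (hY : #Y ≤ 3 * p + 2) :
    #{C ∈ G | #(C \ Y) < p} ≤ 2 ^ #Y * (p * n.choose (p - 1)) := by
  have := mul_le_two_pow_mul_sq hp
  refine (card_filter_sdiff_lt_le G Y (by omega)).trans ?_
  gcongr
  exact Nat.sub_le _ _

lemma card_le_choose_of_sdiff_lt {n p : ℕ} (hp : 1 ≤ p)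
    (hn : 2 ^ (3 * p + 2) * p ^ 2 + p + 1 ≤ n) {G : Finset (Finset (Fin n))}
    {Y : Finset (Fin n)} (hY : #Y ≤ 3 * p + 2) (hG : ∀ C ∈ G, #(C \ Y) < p) :
    #G ≤ n.choose p := by
  rw [← filter_true_of_mem hG]
  refine (card_filter_sdiff_lt_le_choose hp hn G hY).trans
    (le_trans ?_ (two_pow_mul_choose_le hp hn))
  gcongr
  norm_num

lemma card_le_choose_of_card_lt_three {n p : ℕ} (hp : 1 ≤ p)
    (hn : 2 ^ (3 * p + 2) * p ^ 2 + p + 1 ≤ n) {G : Finset (Finset (Fin n))} (hG : #G < 3) :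
    #G ≤ n.choose p := by
  have := mul_le_two_pow_mul_sq hp
  have h1 : n.choose 1 ≤ n.choose p := choose_le_choose_of_le_half hp (by omega)
  rw [Nat.choose_one_right] at h1
  omega

/-! ### Uniform families with intersections of size at least two -/

/-- The Erdős–Ko–Rado bound for uniform families with pairwise intersections of size at least two,
on a large ground set. -/
lemma card_le_of_two_le_card_inter {n p : ℕ} (hp : 1 ≤ p)
    (hn : 2 ^ (3 * p + 2) * p ^ 2 + p + 1 ≤ n) {M : Finset (Finset (Fin n))}
    (hM : ∀ A ∈ M, #A = p + 1) (hM2 : ∀ A ∈ M, ∀ B ∈ M, A ≠ B → 2 ≤ #(A ∩ B)) :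
    #M ≤ (n - 2).choose (p - 1) := by
  have hlarge := mul_le_two_pow_mul_sq hp
  have h2 : ∀ A ∈ M, ∀ B ∈ M, 2 ≤ #(A ∩ B) := by
    intro A hA B hB
    by_cases hAB : A = B
    · subst hAB
      rw [inter_self, hM A hA]
      omega
    · exact hM2 A hA B hB hAB
  -- Meeting Y in three points leaves at most p - 2 points outside, so the count is of order
  -- n^(p-2), below the target.
  have key : ∀ Y : Finset (Fin n), p + 1 ≤ #Y → #Y ≤ 3 * p + 2 → (∀ D ∈ M, 3 ≤ #(D ∩ Y)) →
      #M ≤ (n - 2).choose (p - 1) := by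
    intro Y hY1 hY2 hD
    obtain rfl | ⟨A, hA⟩ := M.eq_empty_or_nonempty
    · simp
    have hp2 : 2 ≤ p := by
      have h3 := hD A hA
      have h4 := card_le_card (inter_subset_left : A ∩ Y ⊆ A)
      rw [hM A hA] at h4
      omega
    have hsmall : ∀ D ∈ M, #(D \ Y) < p - 1 := by
      intro D hDM
      have h3 := hD D hDM
      have h4 := card_sdiff_add_card_inter D Y
      rw [hM D hDM] at h4
      omega
    rw [← filter_true_of_mem hsmall]
    refine (card_filter_sdiff_lt_le M Y (by omega)).trans ?_
    obtain ⟨k, rfl⟩ := Nat.exists_eq_add_of_le' hp2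
    have hle : 2 ^ (3 * (k + 2) + 2) * (k + 1) * (n - 2).choose k ≤ (n - 2).choose (k + 1) := by
      refine mul_choose_le_choose_succ ?_
      have : 2 ^ (3 * (k + 2) + 2) * (k + 1) * (k + 1) ≤ 2 ^ (3 * (k + 2) + 2) * (k + 2) ^ 2 := by
        rw [mul_assoc, sq]
        gcongr <;> omega
      omega
    refine le_trans ?_ hle
    rw [mul_assoc]
    have : (n - #Y).choose k ≤ (n - 2).choose k := Nat.choose_le_choose _ (by omega)
    have h2 : 2 ^ #Y ≤ 2 ^ (3 * (k + 2) + 2) := Nat.pow_le_pow_right (by norm_num) hY2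
    exact Nat.mul_le_mul h2 (Nat.mul_le_mul_left _ this)
  obtain rfl | ⟨A, hA⟩ := M.eq_empty_or_nonempty
  · simp
  by_cases hB : ∃ B ∈ M, #(A ∩ B) = 2
  · obtain ⟨B, hB, hAB⟩ := hB
    by_cases hS : ∀ C ∈ M, A ∩ B ⊆ C
    · have hsub : M ⊆ (powersetCard (p + 1) univ).filter (A ∩ B ⊆ ·) := fun C hC =>
        mem_filter.2 ⟨mem_powersetCard_univ.2 (hM C hC), hS C hC⟩
      refine (card_le_card hsub).trans ?_
      rw [card_filter_powersetCard_subset _ _ _ (subset_univ _) (by omega), hAB, card_univ,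
        Fintype.card_fin]
      rfl
    · push Not at hS
      obtain ⟨C, hC, hSC⟩ := hS
      -- This union has at most 2p + (p - 1) points. A member meeting it in only two points has the
      -- same trace on A, B and C, so that trace is A ∩ B and lies in C, which is excluded.
      refine key (A ∪ B ∪ C) ?_ ?_ ?_
      · rw [← hM A hA]
        exact card_le_card (subset_union_left.trans subset_union_left)
      · have h3 := card_union_add_card_inter A B
        have h4 := card_union_add_card_inter (A ∪ B) C
        have h5 : #(A ∩ C) ≤ #((A ∪ B) ∩ C) :=
          card_le_card (inter_subset_inter_right subset_union_left)
        have h6 := h2 A hA C hC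
        rw [hM A hA, hM B hB] at h3
        rw [hM C hC] at h4
        omega
      · intro D hD
        by_contra! hlt
        have trace : ∀ E ∈ M, E ⊆ A ∪ B ∪ C → D ∩ E = D ∩ (A ∪ B ∪ C) := fun E hE hsub =>
          eq_of_subset_of_card_le (inter_subset_inter_left hsub) (by have := h2 D hD E hE; omega)
        have hA' := trace A hA (subset_union_left.trans subset_union_left)
        have hB' := trace B hB (subset_union_right.trans subset_union_left)
        have hC' := trace C hC subset_union_right
        have h3 : D ∩ A = A ∩ B :=
          eq_of_subset_of_card_le
            (subset_inter inter_subset_right ((hA'.trans hB'.symm).subset.trans inter_subset_right))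
            (by have := h2 D hD A hA; omega)
        exact hSC (h3.symm.subset.trans ((hA'.trans hC'.symm).subset.trans inter_subset_right))
  · push Not at hB
    refine key A (hM A hA).ge (by rw [hM A hA]; omega) fun D hD => ?_
    have h3 := h2 A hA D hD
    have h4 := hB D hD
    rw [inter_comm]
    omega

/-! ### Reduction to small unions and small members -/

lemma exists_mem_ne_ne {α : Type*} [DecidableEq α] {G : Finset α} (hG : 3 ≤ #G) (A B : α) :
    ∃ C ∈ G, C ≠ A ∧ C ≠ B := by
  have h1 : #{A, B} < #G := lt_of_le_of_lt card_le_two hG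
  obtain ⟨C, hC, hC'⟩ := exists_mem_notMem_of_card_lt_card h1
  simp only [mem_insert, mem_singleton, not_or] at hC'
  exact ⟨C, hC, hC'⟩

lemma UnionBounded.card_union_le_of_three_le {n x p : ℕ} {G : Finset (Finset (Fin n))}
    (hG : UnionBounded x G) (hx : x ≤ 6 * p + 5) (h3 : 3 ≤ #G) {A B : Finset (Fin n)} (hA : A ∈ G) (hB : B ∈ G)
    (hAB : A ≠ B) : #(A ∪ B) ≤ 3 * p + 2 := by
  obtain ⟨C, hC, hCA, hCB⟩ := exists_mem_ne_ne h3 A B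
  have h1 := hG A hA B hB C hC hAB hCB.symm hCA.symm
  have h2 := two_mul_card_union_add_le A B C
  omega

/-- Unless the family is small, all pairwise unions have size less than `m`. -/
lemma UnionBounded.card_le_or_union_lt {n x p m : ℕ} (hp : 1 ≤ p)
    (hn : 2 ^ (3 * p + 2) * p ^ 2 + p + 1 ≤ n) {G : Finset (Finset (Fin n))}
    (hG : UnionBounded x G) (hx : x ≤ 6 * p + 5) (hm : x < 2 * m + 2 * p) :
    #G ≤ n.choose p ∨ ∀ A ∈ G, ∀ B ∈ G, A ≠ B → #(A ∪ B) < m := by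
  by_cases h3 : #G < 3
  · exact .inl (card_le_choose_of_card_lt_three hp hn h3)
  refine or_iff_not_imp_right.2 fun hcon => ?_
  push Not at hcon
  obtain ⟨A, hA, B, hB, hAB, hm'⟩ := hcon
  have hY := hG.card_union_le_of_three_le hx (by omega) hA hB hAB
  refine card_le_choose_of_sdiff_lt hp hn hY fun C hC => ?_
  by_cases hCA : C = A
  · rw [hCA, sdiff_eq_empty_iff_subset.2 subset_union_left, card_empty]
    omega
  by_cases hCB : C = B
  · rw [hCB, sdiff_eq_empty_iff_subset.2 subset_union_right, card_empty]
    omega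
  have h1 := hG A hA B hB C hC hAB (Ne.symm hCB) (Ne.symm hCA)
  have h2 := two_mul_card_union_add_le A B C
  omega

/-- Unless the family is small, a bound on the pairwise unions bounds the members. -/
lemma card_le_or_card_lt {n p k : ℕ} (hp : 1 ≤ p)
    (hn : 2 ^ (3 * p + 2) * p ^ 2 + p + 1 ≤ n) {G : Finset (Finset (Fin n))}
    (hk : k ≤ 2 * p + 3) (hG : ∀ A ∈ G, ∀ B ∈ G, A ≠ B → #(A ∪ B) < k + p) :
    #G ≤ n.choose p ∨ ∀ A ∈ G, #A < k := by
  by_cases h3 : #G < 3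
  · exact .inl (card_le_choose_of_card_lt_three hp hn h3)
  refine or_iff_not_imp_right.2 fun hcon => ?_
  push Not at hcon
  obtain ⟨A, hA, hkA⟩ := hcon
  have hle : #A ≤ 3 * p + 2 := by
    obtain ⟨B, hB, hBA, -⟩ := exists_mem_ne_ne (by omega : 3 ≤ #G) A A
    have h1 := hG A hA B hB hBA.symm
    have h2 : #A ≤ #(A ∪ B) := card_le_card subset_union_left
    omega
  refine card_le_choose_of_sdiff_lt hp hn hle fun C hC => ?_
  by_cases hCA : C = A
  · rw [hCA, sdiff_self, bot_eq_empty, card_empty]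
    omega
  have h1 := hG A hA C hC (Ne.symm hCA)
  have h2 := card_sdiff_add_card C A
  rw [union_comm] at h2
  omega

lemma choose_le_sum_range_choose (n p : ℕ) : n.choose p ≤ ∑ i ∈ range (p + 1), n.choose i :=
  single_le_sum (f := n.choose) (fun _ _ => Nat.zero_le _) (self_mem_range_succ p)

lemma card_le_sum_add_card_filter {n p : ℕ} {G : Finset (Finset (Fin n))}
    (hG : ∀ A ∈ G, #A < p + 2) :
    #G ≤ (∑ i ∈ range (p + 1), n.choose i) + #{A ∈ G | #A = p + 1} := by
  rw [← card_filter_card_le]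
  refine le_trans (card_le_card fun A hA => ?_) (card_union_le _ _)
  have := hG A hA
  simp only [mem_union, mem_filter, mem_univ, true_and, hA]
  omega

/-! ### Upper bounds for q ≤ 4 -/

lemma UnionBounded.card_le_of_le_one {n x p : ℕ} (hp : 1 ≤ p)
    (hn : 2 ^ (3 * p + 2) * p ^ 2 + p + 1 ≤ n) {G : Finset (Finset (Fin n))}
    (hG : UnionBounded x G) (hx : x ≤ 6 * p + 1) : #G ≤ ∑ i ∈ range (p + 1), n.choose i := by
  have hle := choose_le_sum_range_choose n p
  obtain h1 | h1 := hG.card_le_or_union_lt (m := 2 * p + 1) hp hn (by omega) (by omega)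
  · exact h1.trans hle
  obtain h2 | h2 := card_le_or_card_lt (k := p + 1) hp hn (by omega)
    (fun A hA B hB hAB => (h1 A hA B hB hAB).trans_le (by omega))
  · exact h2.trans hle
  rw [← card_filter_card_le]
  exact card_le_card fun A hA => mem_filter.2 ⟨mem_univ _, Nat.lt_succ_iff.1 (h2 A hA)⟩

lemma UnionBounded.card_le_of_eq_two {n p : ℕ} (hp : 1 ≤ p)
    (hn : 2 ^ (3 * p + 2) * p ^ 2 + p + 1 ≤ n) {G : Finset (Finset (Fin n))}
    (hG : UnionBounded (6 * p + 2) G) :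
    #G ≤ (∑ i ∈ range (p + 1), n.choose i) + (n - 2).choose (p - 1) := by
  have hle : n.choose p ≤ (∑ i ∈ range (p + 1), n.choose i) + (n - 2).choose (p - 1) :=
    (choose_le_sum_range_choose n p).trans (Nat.le_add_right _ _)
  by_cases h3 : #G < 3
  · exact (card_le_choose_of_card_lt_three hp hn h3).trans hle
  obtain h1 | h1 := hG.card_le_or_union_lt (m := 2 * p + 2) hp hn (by omega) (by omega)
  · exact h1.trans hle
  obtain h2 | h2 := card_le_or_card_lt (k := p + 2) hp hn (by omega)
    (fun A hA B hB hAB => (h1 A hA B hB hAB).trans_le (by omega))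
  · exact h2.trans hle
  by_cases hint : ∀ A ∈ ({A ∈ G | #A = p + 1} : Finset _),
      ∀ B ∈ ({A ∈ G | #A = p + 1} : Finset _), A ≠ B → 2 ≤ #(A ∩ B)
  · exact (card_le_sum_add_card_filter h2).trans (Nat.add_le_add_left
      (card_le_of_two_le_card_inter hp hn (fun A hA => (mem_filter.1 hA).2) hint) _)
  push Not at hint
  obtain ⟨A, hA, B, hB, hAB, hlt⟩ := hint
  obtain ⟨hA, hcA⟩ := mem_filter.1 hA
  obtain ⟨hB, hcB⟩ := mem_filter.1 hB
  have hY := hG.card_union_le_of_three_le (p := p) (by omega) (by omega) hA hB hAB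
  refine le_trans (card_le_choose_of_sdiff_lt hp hn hY fun C hC => ?_) hle
  by_cases hCA : C = A
  · rw [hCA, sdiff_eq_empty_iff_subset.2 subset_union_left, card_empty]
    omega
  by_cases hCB : C = B
  · rw [hCB, sdiff_eq_empty_iff_subset.2 subset_union_right, card_empty]
    omega
  -- `two_mul_card_union_add_le` would be one short here. Using |A| = |B| = p + 1 and |A ∪ B| ≥ 2p +
  -- 1, the three unions total at least 4p + 3 + 2|C \ (A ∪ B)|, which forces fewer than p outside
  -- points.
  have h4 := hG A hA B hB C hC hAB (Ne.symm hCB) (Ne.symm hCA)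
  have h5 := card_union_add_card_inter A B
  have h6 := card_sdiff_add_card C A
  have h7 := card_sdiff_add_card C B
  have h8 : #(C \ (A ∪ B)) ≤ #(C \ A) :=
    card_le_card (sdiff_subset_sdiff subset_rfl subset_union_left)
  have h9 : #(C \ (A ∪ B)) ≤ #(C \ B) :=
    card_le_card (sdiff_subset_sdiff subset_rfl subset_union_right)
  rw [union_comm] at h7
  omega

/-- If all pairwise unions have size at most `2p + 1`, the Erdős–Ko–Rado theorem applies to the
members of size `p + 1`. -/
lemma card_le_of_union_lt {n p : ℕ} (hp : 1 ≤ p)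
    (hn : 2 ^ (3 * p + 2) * p ^ 2 + p + 1 ≤ n) {G : Finset (Finset (Fin n))}
    (hG : ∀ A ∈ G, ∀ B ∈ G, A ≠ B → #(A ∪ B) < 2 * p + 2) :
    #G ≤ (∑ i ∈ range (p + 1), n.choose i) + (n - 1).choose p := by
  have hlarge := mul_le_two_pow_mul_sq hp
  obtain h2 | h2 := card_le_or_card_lt (k := p + 2) hp hn (by omega)
    (fun A hA B hB hAB => (hG A hA B hB hAB).trans_le (by omega))
  · exact h2.trans ((choose_le_sum_range_choose n p).trans (Nat.le_add_right _ _))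
  refine (card_le_sum_add_card_filter h2).trans (Nat.add_le_add_left ?_ _)
  refine erdos_ko_rado (r := p + 1) ?_ (fun A hA => (mem_filter.1 (mem_coe.1 hA)).2) (by omega)
  intro A hA B hB hAB
  obtain ⟨hA, hcA⟩ := mem_filter.1 (mem_coe.1 hA)
  obtain ⟨hB, hcB⟩ := mem_filter.1 (mem_coe.1 hB)
  have hne : A ≠ B := by
    rintro rfl
    rw [disjoint_self_iff_empty] at hAB
    simp [hAB] at hcA
  have h4 := hG A hA B hB hne
  rw [card_union_of_disjoint hAB] at h4
  omega

/-- The members of a family containing two sets with union of size `2p + 2`. -/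
lemma UnionBounded.sdiff_lt_or_of_card_union_eq {n p q : ℕ} (hp : 1 ≤ p) (hq : q ≤ 5)
    {G : Finset (Finset (Fin n))} (hG : UnionBounded (6 * p + q) G) {A B : Finset (Fin n)}
    (hA : A ∈ G) (hB : B ∈ G) (hAB : A ≠ B) (hc : #(A ∪ B) = 2 * p + 2) {C : Finset (Fin n)}
    (hC : C ∈ G) :
    #(C \ (A ∪ B)) < p ∨ #(C \ (A ∪ B)) = p ∧ #(C ∩ (A ∪ B)) + 4 ≤ q := by
  by_cases hCA : C = A
  · rw [hCA, sdiff_eq_empty_iff_subset.2 subset_union_left, card_empty]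
    exact .inl hp
  by_cases hCB : C = B
  · rw [hCB, sdiff_eq_empty_iff_subset.2 subset_union_right, card_empty]
    exact .inl hp
  have h1 := hG A hA B hB C hC hAB (Ne.symm hCB) (Ne.symm hCA)
  have h2 := two_mul_card_union_add_le A B C
  omega

lemma UnionBounded.card_le_of_le_four {n p q : ℕ} (hp : 1 ≤ p)
    (hn : 2 ^ (3 * p + 2) * p ^ 2 + p + 1 ≤ n) (hq : q ≤ 4) {G : Finset (Finset (Fin n))}
    (hG : UnionBounded (6 * p + q) G) :
    #G ≤ (∑ i ∈ range (p + 1), n.choose i) + (n - 1).choose p := by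
  have hle := choose_le_sum_range_choose n p
  obtain h1 | h1 := hG.card_le_or_union_lt (m := 2 * p + 3) hp hn (by omega) (by omega)
  · exact h1.trans (hle.trans (Nat.le_add_right _ _))
  by_cases h2 : ∀ A ∈ G, ∀ B ∈ G, A ≠ B → #(A ∪ B) < 2 * p + 2
  · exact card_le_of_union_lt hp hn h2
  push Not at h2
  obtain ⟨A, hA, B, hB, hAB, hc⟩ := h2
  replace hc : #(A ∪ B) = 2 * p + 2 := by have := h1 A hA B hB hAB; omega
  have hsub : G ⊆ ({C ∈ G | #(C \ (A ∪ B)) < p} : Finset _) ∪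
      {C ∈ G | C ∩ (A ∪ B) = ∅ ∧ #(C \ (A ∪ B)) = p} := by
    intro C hC
    rw [mem_union, mem_filter, mem_filter]
    refine (hG.sdiff_lt_or_of_card_union_eq hp (by omega) hA hB hAB hc hC).imp (⟨hC, ·⟩) ?_
    exact fun h => ⟨hC, card_eq_zero.1 (by omega), h.1⟩
  refine (card_le_card hsub).trans ((card_union_le _ _).trans (Nat.add_le_add ?_ ?_))
  · refine (card_filter_sdiff_lt_le_choose hp hn G (by omega)).trans
      (le_trans ?_ ((two_pow_mul_choose_le hp hn).trans hle))
    exact Nat.mul_le_mul_right _ (Nat.pow_le_pow_right (by norm_num) (by omega))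
  · exact (card_filter_trace_le _ _ _).trans (Nat.choose_le_choose _ (by omega))

/-! ### The extremal families -/

lemma card_filter_powersetCard_mem_or_mem {n : ℕ} (k : ℕ) {a b : Fin n} (hab : a ≠ b) :
    #{S ∈ powersetCard (k + 1) (univ : Finset (Fin n)) | a ∈ S ∨ b ∈ S} =
      (n - 1).choose k + (n - 2).choose k := by
  have h1 := card_filter_add_card_filter_not (s := powersetCard (k + 1) (univ : Finset (Fin n)))
    (fun S => a ∈ S ∨ b ∈ S)
  have h2 : ({S ∈ powersetCard (k + 1) (univ : Finset (Fin n)) | ¬(a ∈ S ∨ b ∈ S)} : Finset _) =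
      powersetCard (k + 1) {a, b}ᶜ := by
    ext S
    simp only [mem_filter, mem_powersetCard, subset_univ, true_and, subset_compl_comm (s := S),
      insert_subset_iff, singleton_subset_iff, mem_compl]
    tauto
  rw [h2, card_powersetCard, card_powersetCard, card_compl, card_pair hab, card_univ,
    Fintype.card_fin] at h1
  obtain ⟨m, rfl⟩ : ∃ m, n = m + 2 := by
    have := Fintype.one_lt_card_iff.2 ⟨a, b, hab⟩
    rw [Fintype.card_fin] at this
    exact ⟨n - 2, by omega⟩
  have h3 : (m + 2).choose (k + 1) = (m + 1).choose k + (m + 1).choose (k + 1) :=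
    Nat.choose_succ_succ _ _
  have h4 : (m + 1).choose (k + 1) = m.choose k + m.choose (k + 1) := Nat.choose_succ_succ _ _
  rw [Nat.add_sub_cancel] at h1 ⊢
  rw [show m + 2 - 1 = m + 1 from rfl]
  omega

/-- All sets of size at most `p`, together with the sets of size `p + 1` satisfying `P`. -/
def ballWith (n p : ℕ) (P : Finset (Fin n) → Prop) [DecidablePred P] : Finset (Finset (Fin n)) :=
  univ.filter (#· ≤ p) ∪ (powersetCard (p + 1) univ).filter P

lemma mem_ballWith {n p : ℕ} {P : Finset (Fin n) → Prop} [DecidablePred P] {S : Finset (Fin n)} :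
    S ∈ ballWith n p P ↔ #S ≤ p ∨ #S = p + 1 ∧ P S := by
  simp [ballWith]

lemma card_ballWith {n p : ℕ} {P : Finset (Fin n) → Prop} [DecidablePred P] :
    #(ballWith n p P) = (∑ i ∈ range (p + 1), n.choose i) +
      #{S ∈ powersetCard (p + 1) (univ : Finset (Fin n)) | P S} := by
  rw [ballWith, card_union_of_disjoint, card_filter_card_le]
  rw [disjoint_left]
  intro S h1 h2
  have h1 := (mem_filter.1 h1).2
  have h2 := mem_powersetCard_univ.1 (mem_filter.1 h2).1
  omega

lemma unionBounded_ball (n p : ℕ) :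
    UnionBounded (6 * p) ({S | #S ≤ p} : Finset (Finset (Fin n))) := by
  intro A hA B hB C hC _ _ _
  have hA := (mem_filter.1 hA).2
  have hB := (mem_filter.1 hB).2
  have hC := (mem_filter.1 hC).2
  have h1 := card_union_le A B
  have h2 := card_union_le B C
  have h3 := card_union_le C A
  omega

/-- If the members of size `p + 1` contain a common set `K`, then so do their intersections. -/
lemma card_union_add_le_of_mem_ballWith {n p : ℕ} {K A B : Finset (Fin n)}
    (hA : A ∈ ballWith n p (K ⊆ ·)) (hB : B ∈ ballWith n p (K ⊆ ·)) :
    #A ≤ p + 1 ∧ #(A ∪ B) ≤ #A + #B ∧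
      (#A = p + 1 → #B = p + 1 → #(A ∪ B) + #K ≤ 2 * p + 2) := by
  rw [mem_ballWith] at hA hB
  refine ⟨by omega, card_union_le A B, fun h1 h2 => ?_⟩
  have h3 : #K ≤ #(A ∩ B) := card_le_card (subset_inter
    (hA.resolve_left (by omega)).2 (hB.resolve_left (by omega)).2)
  have h4 := card_union_add_card_inter A B
  omega

lemma unionBounded_ballWith_pair {n p : ℕ} {a b : Fin n} (hab : a ≠ b) :
    UnionBounded (6 * p + 2) (ballWith n p ({a, b} ⊆ ·)) := by
  intro A hA B hB C hC _ _ _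
  have h1 := card_union_add_le_of_mem_ballWith hA hB
  have h2 := card_union_add_le_of_mem_ballWith hB hC
  have h3 := card_union_add_le_of_mem_ballWith hC hA
  rw [card_pair hab] at h1 h2 h3
  omega

lemma unionBounded_ballWith_singleton {n p : ℕ} (a : Fin n) :
    UnionBounded (6 * p + 3) (ballWith n p ({a} ⊆ ·)) := by
  intro A hA B hB C hC _ _ _
  have h1 := card_union_add_le_of_mem_ballWith hA hB
  have h2 := card_union_add_le_of_mem_ballWith hB hC
  have h3 := card_union_add_le_of_mem_ballWith hC hA
  rw [card_singleton] at h1 h2 h3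
  omega

/-- Among three (p+1)-sets meeting {a, b}, two share a or b, which saves one from 6p + 6; if some
set has size at most p, the trivial bound is already 6p + 4. -/
lemma unionBounded_ballWith_or {n p : ℕ} (a b : Fin n) :
    UnionBounded (6 * p + 5) (ballWith n p fun S => a ∈ S ∨ b ∈ S) := by
  have share (c : Fin n) (S T : Finset (Fin n)) (hS : c ∈ S) (hT : c ∈ T) :
      #(S ∪ T) + 1 ≤ #S + #T := by
    have h1 := card_union_add_card_inter S T
    have h2 : 0 < #(S ∩ T) := card_pos.2 ⟨c, mem_inter.2 ⟨hS, hT⟩⟩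
    omega
  intro A hA B hB C hC _ _ _
  rw [mem_ballWith] at hA hB hC
  have h1 := card_union_le A B
  have h2 := card_union_le B C
  have h3 := card_union_le C A
  rcases hA with hA | ⟨hA, hA'⟩
  · omega
  rcases hB with hB | ⟨hB, hB'⟩
  · omega
  rcases hC with hC | ⟨hC, hC'⟩
  · omega
  have : #(A ∪ B) + 1 ≤ #A + #B ∨ #(B ∪ C) + 1 ≤ #B + #C ∨ #(C ∪ A) + 1 ≤ #C + #A := by
    rcases hA' with hA' | hA' <;> rcases hB' with hB' | hB'
    · exact .inl (share a A B hA' hB')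
    · rcases hC' with hC' | hC'
      · exact .inr (.inr (share a C A hC' hA'))
      · exact .inr (.inl (share b B C hB' hC'))
    · rcases hC' with hC' | hC'
      · exact .inr (.inl (share a B C hB' hC'))
      · exact .inr (.inr (share b C A hC' hA'))
    · exact .inl (share b A B hA' hB')
  omega

/-! ### Upper bound for q = 5 -/

/-- Two large traces `{a}` and `{b}` with `p` further elements force every member into the extremal
family. -/
lemma UnionBounded.subset_ballWith_or {n p : ℕ} (hp : 1 ≤ p) {G : Finset (Finset (Fin n))}
    (hG : UnionBounded (6 * p + 5) G) (hcard : ∀ E ∈ G, #E ≤ 2 * p + 2) {Y : Finset (Fin n)}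
    {a b : Fin n} (ha : a ∈ Y) (hb : b ∈ Y) (hab : a ≠ b)
    (hGa : (3 * p + 2) * (n - 1).choose (p - 1) < #{C ∈ G | C ∩ Y = {a} ∧ #(C \ Y) = p})
    (hGb : (3 * p + 2) * (n - 1).choose (p - 1) < #{C ∈ G | C ∩ Y = {b} ∧ #(C \ Y) = p}) :
    G ⊆ ballWith n p fun S => a ∈ S ∨ b ∈ S := by
  intro E hE
  have hEc := hcard E hE
  obtain ⟨C, hC, hCa, hCp, hCE⟩ := exists_trace_disjoint (Z := E) hp
    ((Nat.mul_le_mul_right _ (by omega)).trans_lt hGa)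
  -- The factor 3p + 2 in the hypotheses is this bound, (2p + 2) + p: D must avoid E and C outside
  -- Y.
  have hZ : #(E ∪ C \ Y) ≤ 3 * p + 2 := (card_union_le _ _).trans (by omega)
  obtain ⟨D, hD, hDb, hDp, hDE⟩ := exists_trace_disjoint (Z := E ∪ C \ Y) hp
    ((Nat.mul_le_mul_right _ hZ).trans_lt hGb)
  rw [disjoint_union_right] at hDE
  have grow (c : Fin n) (S : Finset (Fin n)) (hc : c ∈ Y) (hS : S ∩ Y = {c}) (hSp : #(S \ Y) = p)
      (hSE : Disjoint (S \ Y) E) : E ≠ S ∧ #(insert c E) + p ≤ #(E ∪ S) := by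
    have hcS : c ∈ S := (mem_inter.1 (hS ▸ mem_singleton_self c : c ∈ S ∩ Y)).1
    constructor
    · rintro rfl
      have := disjoint_self_iff_empty _ |>.1 (hSE.mono_right (sdiff_subset (t := Y)))
      rw [this, card_empty] at hSp
      omega
    · have hdis : Disjoint (insert c E) (S \ Y) := by
        rw [disjoint_insert_left]
        exact ⟨fun h => (mem_sdiff.1 h).2 hc, hSE.symm⟩
      rw [← hSp, ← card_union_of_disjoint hdis]
      refine card_le_card (union_subset ?_ ?_)
      · exact insert_subset (mem_union_right _ hcS) subset_union_left
      · exact sdiff_subset.trans subset_union_right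
  obtain ⟨hEC, h1⟩ := grow a C ha hCa hCp hCE
  obtain ⟨hED, h2⟩ := grow b D hb hDb hDp hDE.1
  have hCD : C ≠ D := by
    rintro rfl
    exact hab (singleton_injective (hCa.symm.trans hDb))
  have h3 : 2 * p + 2 ≤ #(C ∪ D) := by
    have hdis : Disjoint C D := by
      rw [disjoint_left]
      intro c hc hd
      by_cases hcY : c ∈ Y
      · have h4 : c ∈ C ∩ Y := mem_inter.2 ⟨hc, hcY⟩
        have h5 : c ∈ D ∩ Y := mem_inter.2 ⟨hd, hcY⟩
        rw [hCa, mem_singleton] at h4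
        rw [hDb, mem_singleton] at h5
        exact hab (h4.symm.trans h5)
      · exact disjoint_left.1 hDE.2 (mem_sdiff.2 ⟨hd, hcY⟩) (mem_sdiff.2 ⟨hc, hcY⟩)
    rw [card_union_of_disjoint hdis, ← card_sdiff_add_card_inter C Y,
      ← card_sdiff_add_card_inter D Y, hCa, hDb, hCp, hDp, card_singleton, card_singleton]
    omega
  -- With |C ∪ D| ≥ 2p + 2 this leaves |E ∪ {a}| + |E ∪ {b}| ≤ 2p + 3, so |E| ≤ p + 1, and |E| ≤ p
  -- if E misses both points.
  have h4 := hG E hE C hC D hD hEC hCD hED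
  rw [union_comm D E] at h4
  rw [mem_ballWith]
  by_cases haE : a ∈ E <;> by_cases hbE : b ∈ E <;>
    simp only [haE, hbE, insert_eq_of_mem, card_insert_of_notMem, not_false_eq_true, or_self,
      or_true, true_or, and_true] at h1 h2 ⊢ <;> omega

lemma mul_add_two_pow_mul_le {p : ℕ} (hp : 1 ≤ p) :
    (2 * p + 1) * (3 * p + 2) + 2 ^ (2 * p + 2) * p ≤ 2 ^ (3 * p + 2) * p := by
  have h1 : p + 1 ≤ 2 ^ p := Nat.lt_two_pow_self
  have h2 : 2 ^ (2 * p + 2) = 4 * (2 ^ p * 2 ^ p) := by ring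
  have h3 : 2 ^ (3 * p + 2) = 2 ^ (2 * p + 2) * 2 ^ p := by ring
  have h4 : 4 * ((p + 1) * (p + 1)) ≤ 2 ^ (2 * p + 2) := by
    rw [h2]
    gcongr
  have h5 : 2 ^ (2 * p + 2) * (p + 1) * p ≤ 2 ^ (3 * p + 2) * p := by
    rw [h3]
    gcongr
  -- It remains that (2p+1)(3p+2) ≤ 4(p+1)²p², which is 15 ≤ 16 at p = 1.
  nlinarith [Nat.mul_le_mul h4 (Nat.mul_le_mul hp hp), Nat.mul_le_mul_right (p * p) h4]

lemma UnionBounded.card_le_of_eq_five {n p : ℕ} (hp : 1 ≤ p)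
    (hn : 2 ^ (3 * p + 2) * p ^ 2 + p + 1 ≤ n) {G : Finset (Finset (Fin n))}
    (hG : UnionBounded (6 * p + 5) G) :
    #G ≤ (∑ i ∈ range (p + 1), n.choose i) + (n - 1).choose p + (n - 2).choose p := by
  have hle := choose_le_sum_range_choose n p
  obtain h1 | h1 := hG.card_le_or_union_lt (m := 2 * p + 3) hp hn (by omega) (by omega)
  · exact h1.trans (by omega)
  by_cases h2 : ∀ A ∈ G, ∀ B ∈ G, A ≠ B → #(A ∪ B) < 2 * p + 2
  · exact (card_le_of_union_lt hp hn h2).trans (Nat.le_add_right _ _)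
  push Not at h2
  obtain ⟨A, hA, B, hB, hAB, hc⟩ := h2
  replace hc : #(A ∪ B) = 2 * p + 2 := by have := h1 A hA B hB hAB; omega
  have hcard : ∀ E ∈ G, #E ≤ 2 * p + 2 := by
    intro E hE
    obtain ⟨D, hD, hED⟩ : ∃ D ∈ G, E ≠ D := by
      by_cases hEA : E = A
      · exact ⟨B, hB, hEA ▸ hAB⟩
      · exact ⟨A, hA, hEA⟩
    exact (card_le_card subset_union_left).trans (Nat.lt_succ_iff.1 (h1 E hE D hD hED))
  have key := fun C (hC : C ∈ G) =>
    hG.sdiff_lt_or_of_card_union_eq hp le_rfl hA hB hAB hc hC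
  generalize A ∪ B = Y at hc key
  by_cases hlarge : ∃ a ∈ Y, ∃ b ∈ Y, a ≠ b ∧
      (3 * p + 2) * (n - 1).choose (p - 1) < #{C ∈ G | C ∩ Y = {a} ∧ #(C \ Y) = p} ∧
      (3 * p + 2) * (n - 1).choose (p - 1) < #{C ∈ G | C ∩ Y = {b} ∧ #(C \ Y) = p}
  · obtain ⟨a, ha, b, hb, hab, hGa, hGb⟩ := hlarge
    refine (card_le_card (hG.subset_ballWith_or hp hcard ha hb hab hGa hGb)).trans ?_
    rw [card_ballWith, card_filter_powersetCard_mem_or_mem _ hab, add_assoc]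
  have hone : ∃ a ∈ Y, ∀ b ∈ Y.erase a,
      #{C ∈ G | C ∩ Y = {b} ∧ #(C \ Y) = p} ≤ (3 * p + 2) * (n - 1).choose (p - 1) := by
    by_cases hex : ∃ a ∈ Y,
        (3 * p + 2) * (n - 1).choose (p - 1) < #{C ∈ G | C ∩ Y = {a} ∧ #(C \ Y) = p}
    · obtain ⟨a, ha, hGa⟩ := hex
      refine ⟨a, ha, fun b hb => not_lt.1 fun hGb => hlarge ?_⟩
      exact ⟨a, ha, b, mem_of_mem_erase hb, (ne_of_mem_erase hb).symm, hGa, hGb⟩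
    · push Not at hex
      obtain ⟨a, ha⟩ : Y.Nonempty := card_pos.1 (by omega)
      exact ⟨a, ha, fun b hb => hex b (mem_of_mem_erase hb)⟩
  obtain ⟨a, ha, hb⟩ := hone
  -- The first group, with the 2p + 1 infrequent singleton traces, is absorbed by C(n,p); the traces
  -- {a} and ∅ account for the other two binomials.
  have hsub : G ⊆ (({C ∈ G | #(C \ Y) < p} : Finset _) ∪
      (Y.erase a).biUnion fun b => {C ∈ G | C ∩ Y = {b} ∧ #(C \ Y) = p}) ∪
      ({C ∈ G | C ∩ Y = {a} ∧ #(C \ Y) = p} ∪ {C ∈ G | C ∩ Y = ∅ ∧ #(C \ Y) = p}) := by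
    intro C hC
    simp only [mem_union, mem_biUnion, mem_filter, hC, true_and]
    rcases key C hC with h | ⟨h, h'⟩
    · exact .inl (.inl h)
    obtain h0 | h0 : #(C ∩ Y) = 0 ∨ #(C ∩ Y) = 1 := by omega
    · exact .inr (.inr ⟨card_eq_zero.1 h0, h⟩)
    obtain ⟨b, hbC⟩ := card_eq_one.1 h0
    by_cases hba : b = a
    · exact .inr (.inl ⟨hba ▸ hbC, h⟩)
    · have hbY : b ∈ Y := (mem_inter.1 (hbC ▸ mem_singleton_self b : b ∈ C ∩ Y)).2
      exact .inl (.inr ⟨b, mem_erase.2 ⟨hba, hbY⟩, hbC, h⟩)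
  have hsmall := card_filter_sdiff_lt_le_choose hp hn G (Y := Y) (by omega)
  have hrest := card_biUnion_le_card_mul (Y.erase a)
    (fun b => ({C ∈ G | C ∩ Y = {b} ∧ #(C \ Y) = p} : Finset _)) _ hb
  have hsing := card_filter_trace_le (p := p) G Y {a}
  have hempty := card_filter_trace_le (p := p) G Y ∅
  rw [card_erase_of_mem ha, hc] at hrest
  rw [hc] at hsmall hsing hempty
  have hmain : 2 ^ (2 * p + 2) * (p * n.choose (p - 1)) +
      (2 * p + 2 - 1) * ((3 * p + 2) * (n - 1).choose (p - 1)) ≤ n.choose p := by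
    refine le_trans ?_ (two_pow_mul_choose_le hp hn)
    have h3 : (n - 1).choose (p - 1) ≤ n.choose (p - 1) :=
      Nat.choose_le_choose _ (Nat.sub_le _ _)
    calc _ ≤ 2 ^ (2 * p + 2) * (p * n.choose (p - 1)) +
          (2 * p + 1) * ((3 * p + 2) * n.choose (p - 1)) := by gcongr; omega
      _ = ((2 * p + 1) * (3 * p + 2) + 2 ^ (2 * p + 2) * p) * n.choose (p - 1) := by ring
      _ ≤ 2 ^ (3 * p + 2) * p * n.choose (p - 1) :=
        Nat.mul_le_mul_right _ (mul_add_two_pow_mul_le hp)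
      _ = _ := mul_assoc _ _ _
  have h4 : (n - (2 * p + 2)).choose p ≤ (n - 1).choose p := Nat.choose_le_choose _ (by omega)
  have h5 : (n - (2 * p + 2)).choose p ≤ (n - 2).choose p := Nat.choose_le_choose _ (by omega)
  have hunion := (card_le_card hsub).trans ((card_union_le _ _).trans
    (Nat.add_le_add (card_union_le _ _) (card_union_le _ _)))
  omega

/-! ### Combining the bounds -/

lemma UnionBounded.mono {n x y : ℕ} {G : Finset (Finset (Fin n))} (hG : UnionBounded x G)
    (hxy : x ≤ y) : UnionBounded y G :=
  fun A hA B hB C hC h1 h2 h3 => (hG A hA B hB C hC h1 h2 h3).trans hxy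

end TripleSystem

open TripleSystem

theorem mainTheorem1 (n x p q : ℕ) (hx : x = 6 * p + q) (hp : 1 ≤ p) (hq : q ≤ 5)
    (hn : 2 ^ (3 * p + 2) * p ^ 2 + p + 1 ≤ n) :
    (q = 0 ∨ q = 1 → TripleSystem.h n (3 * n - x) = (∑ i ∈ Finset.range (p + 1), n.choose i)) ∧
    (q = 2 → TripleSystem.h n (3 * n - x) =
      (∑ i ∈ Finset.range (p + 1), n.choose i) + (n - 2).choose (p - 1)) ∧
    (q = 3 ∨ q = 4 → TripleSystem.h n (3 * n - x) =
      (∑ i ∈ Finset.range (p + 1), n.choose i) + (n - 1).choose p) ∧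
    (q = 5 → TripleSystem.h n (3 * n - x) =
      (∑ i ∈ Finset.range (p + 1), n.choose i) + (n - 1).choose p + (n - 2).choose p) := by
  subst hx
  obtain ⟨a, b, hab⟩ : ∃ a b : Fin n, a ≠ b :=
    ⟨⟨0, by omega⟩, ⟨1, by omega⟩, by simp⟩
  refine ⟨fun h => ?_, ?_, fun h => ?_, ?_⟩
  · exact h_eq_of_unionBounded (fun G hG => hG.card_le_of_le_one hp hn (by omega))
      ⟨_, (unionBounded_ball n p).mono (by omega), card_filter_card_le⟩
  · rintro rfl
    refine h_eq_of_unionBounded (fun G hG => hG.card_le_of_eq_two hp hn)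
      ⟨_, unionBounded_ballWith_pair hab, ?_⟩
    rw [card_ballWith, Finset.card_filter_powersetCard_subset _ _ _ (Finset.subset_univ _)
      (by rw [Finset.card_pair hab]; omega), Finset.card_pair hab, Finset.card_univ,
      Fintype.card_fin]
    rfl
  · refine h_eq_of_unionBounded (fun G hG => hG.card_le_of_le_four hp hn (by omega))
      ⟨_, (unionBounded_ballWith_singleton (p := p) a).mono (by omega), ?_⟩
    rw [card_ballWith, Finset.card_filter_powersetCard_subset _ _ _ (Finset.subset_univ _)
      (by rw [Finset.card_singleton]; omega), Finset.card_singleton, Finset.card_univ,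
      Fintype.card_fin, Nat.add_sub_cancel]
  · rintro rfl
    refine h_eq_of_unionBounded (fun G hG => hG.card_le_of_eq_five hp hn)
      ⟨_, unionBounded_ballWith_or a b, ?_⟩
    rw [card_ballWith, card_filter_powersetCard_mem_or_mem _ hab, add_assoc]
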